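/- For a permutation $w=a_1\cdots a_n\in S_n$ let $\mathfrak S_w\in\mathbb Z[x_1,\dots,x_n]$ be its Schubert polynomial: $\mathfrak S_{w_0}=x_1^{n-1}x_2^{n-2}\cdots x_{n-1}$ for $w_0=n\cdots 21$, and $\mathfrak S_w=\partial_i\mathfrak S_{ws_i}$ whenever $a_i<a_{i+1}$, where $s_i=(i,i+1)$ and $$\partial_i f=\frac{f(x_1,\dots,x_i,x_{i+1},\dots,x_n)-f(x_1,\dots,x_{i+1},x_i,\dots,x_n)}{x_i-x_{i+1}}.$$ Put $\nu_w=\mathfrak S_w(1,\dots,1)$ and, for $v=v_1\cdots v_n\in S_n$, $\lambda_i(v)=\#\{j>i : v_j<v_i\}$. An occurrence of the pattern 132 in $w$ is a triple of positions $i<j<k$ with $a_i<a_k<a_j$; $w$ is called dominant if it has none. Suppose that $w$ has exactly one occurrence of the pattern 132. Then $\nu_w=2$. More precisely, there are positions $i$ and $k>i+1$ such that the unique occurrence is $a_i,a_{i+1},a_k$, and for $w'=ws_i$, the permutation obtained from $w$ by exchanging $a_i$ and $a_{i+1}$: 1. $w'$ is dominant and $\lambda_i(w')=\lambda_{i+1}(w')+2$;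 2. $\mathfrak S_{w'}=x_1^{\lambda_1(w')}x_2^{\lambda_2(w')}\cdots x_{n-1}^{\lambda_{n-1}(w')}$ and $\mathfrak S_w=\partial_i\mathfrak S_{w'}$; 3. $\mathfrak S_w$ is the sum of two distinct monomials, each with coefficient $1$. -/

import Mathlib

namespace Schubert

open MvPolynomial

/-- The difference of a polynomial and its image under exchanging two variables is divisible by the
difference of these variables. -/
theorem sub_dvd_sub_rename_swap {n : ℕ} (i j : Fin n) (f : MvPolynomial (Fin n) ℤ) :
    (X i - X j : MvPolynomial (Fin n) ℤ) ∣ f - rename (Equiv.swap i j) f := by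
  induction f using MvPolynomial.induction_on with
  | C a => simp
  | add p q hp hq =>
    have h := dvd_add hp hq
    rw [map_add]
    convert h using 1
    ring
  | mul_X p m hp =>
    have hX : (X i - X j : MvPolynomial (Fin n) ℤ) ∣ X m - X (Equiv.swap i j m) := by
      rcases eq_or_ne m i with rfl | hi
      · simp
      · rcases eq_or_ne m j with rfl | hj
        · rw [Equiv.swap_apply_right, ← neg_sub (X i)]
          exact (dvd_neg).2 dvd_rfl
        · simp [Equiv.swap_apply_of_ne_of_ne hi hj]
    rw [map_mul, rename_X]
    have h := dvd_add (hp.mul_right (X m)) (hX.mul_left (rename (Equiv.swap i j) p))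
    convert h using 1
    ring

/-- The divided difference `(f - s f) / (x_i - x_j)`, where `s` exchanges `x_i` and `x_j`.
For `i ≠ j` this is the unique polynomial with
`f - s f = (x_i - x_j) * divDiff i j f`, because the polynomial ring is a domain. -/
noncomputable def divDiff {n : ℕ} (i j : Fin n) (f : MvPolynomial (Fin n) ℤ) :
    MvPolynomial (Fin n) ℤ :=
  Classical.choose (sub_dvd_sub_rename_swap i j f)

theorem divDiff_spec {n : ℕ} (i j : Fin n) (f : MvPolynomial (Fin n) ℤ) :
    f - rename (Equiv.swap i j) f = (X i - X j) * divDiff i j f :=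
  Classical.choose_spec (sub_dvd_sub_rename_swap i j f)

/-- `i`, `j` are consecutive positions at which the word `w 0, w 1, …, w (n - 1)` ascends. -/
def IsAscent {n : ℕ} (w : Equiv.Perm (Fin n)) (i j : Fin n) : Prop :=
  (i : ℕ) + 1 = j ∧ w i < w j

/-- Exchanging the entries at an ascent decreases `∑ p, p * w p`. -/
theorem sum_mul_swap_lt {n : ℕ} (w : Equiv.Perm (Fin n)) (i j : Fin n) (h : IsAscent w i j) :
    ∑ p : Fin n, (p : ℕ) * ((w * Equiv.swap i j) p : ℕ) < ∑ p : Fin n, (p : ℕ) * (w p : ℕ) := by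
  obtain ⟨hij, hw⟩ := h
  have hne : j ≠ i := by
    rintro rfl
    omega
  have hj : j ∈ Finset.univ.erase i := by simp [hne]
  rw [← Finset.add_sum_erase _ _ (Finset.mem_univ i), ← Finset.add_sum_erase _ _ hj,
    ← Finset.add_sum_erase _ (fun p : Fin n => (p : ℕ) * (w p : ℕ)) (Finset.mem_univ i),
    ← Finset.add_sum_erase _ (fun p : Fin n => (p : ℕ) * (w p : ℕ)) hj]
  have hrest : ∑ p ∈ (Finset.univ.erase i).erase j, (p : ℕ) * ((w * Equiv.swap i j) p : ℕ)
      = ∑ p ∈ (Finset.univ.erase i).erase j, (p : ℕ) * (w p : ℕ) := by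
    refine Finset.sum_congr rfl fun p hp => ?_
    simp only [Finset.mem_erase, Finset.mem_univ, and_true] at hp
    rw [Equiv.Perm.mul_apply, Equiv.swap_apply_of_ne_of_ne hp.2 hp.1]
  have hlt : (w i : ℕ) < (w j : ℕ) := hw
  rw [hrest]
  simp only [Equiv.Perm.mul_apply, Equiv.swap_apply_left, Equiv.swap_apply_right, ← hij]
  nlinarith

/-- There is a least position at which a permutation with an ascent ascends. -/
theorem exists_first_ascent {n : ℕ} {w : Equiv.Perm (Fin n)}
    (h : ∃ p : Fin n × Fin n, IsAscent w p.1 p.2) :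
    ∃ p : Fin n × Fin n, IsAscent w p.1 p.2 ∧
      ∀ q : Fin n × Fin n, IsAscent w q.1 q.2 → p.1 ≤ q.1 := by
  obtain ⟨p, hp, hmin⟩ := WellFounded.has_min
    (InvImage.wf (fun p : Fin n × Fin n => p.1) (wellFounded_lt (α := Fin n)))
    {p | IsAscent w p.1 p.2} h
  exact ⟨p, hp, fun q hq => not_lt.1 (hmin q hq)⟩

open Classical in
/-- The Schubert polynomial of `w`, in the variables `x_0, …, x_{n-1}` (the positions are numbered
from `0`). The only permutation without an ascent is the longest one, `w₀`, whose polynomial is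
`x_0^{n-1} x_1^{n-2} ⋯ x_{n-2}`; otherwise `𝔖_w = ∂_i 𝔖_{w s_i}` for an ascent `i` of `w`. By the
braid relations for divided differences the ascent does not matter; the first one is taken. This
is `∂_{a_1} ⋯ ∂_{a_p} x^δ` for a reduced word `a_1 ⋯ a_p` of `w⁻¹ w₀`. -/
noncomputable def schubert {n : ℕ} (w : Equiv.Perm (Fin n)) : MvPolynomial (Fin n) ℤ :=
  if h : ∃ p : Fin n × Fin n, IsAscent w p.1 p.2 then
    divDiff (exists_first_ascent h).choose.1 (exists_first_ascent h).choose.2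
      (schubert (w * Equiv.swap (exists_first_ascent h).choose.1 (exists_first_ascent h).choose.2))
  else ∏ i : Fin n, X i ^ (n - 1 - (i : ℕ))
termination_by ∑ p : Fin n, (p : ℕ) * (w p : ℕ)
decreasing_by exact sum_mul_swap_lt w _ _ (exists_first_ascent h).choose_spec.1

/-- The sum of the coefficients of the Schubert polynomial, `ν_w = 𝔖_w(1, …, 1)`. -/
noncomputable def nu {n : ℕ} (w : Equiv.Perm (Fin n)) : ℤ :=
  eval (fun _ => 1) (schubert w)

/-- The occurrences of the pattern 132 in `w`, as triples of positions. -/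
def occurrences132 {n : ℕ} (w : Equiv.Perm (Fin n)) : Finset (Fin n × Fin n × Fin n) :=
  {t | t.1 < t.2.1 ∧ t.2.1 < t.2.2 ∧ w t.1 < w t.2.2 ∧ w t.2.2 < w t.2.1}

/-- A permutation is dominant if it avoids the pattern 132. -/
def IsDominant {n : ℕ} (w : Equiv.Perm (Fin n)) : Prop :=
  occurrences132 w = ∅

/-- `λ_i(v)`, the number of later entries that are smaller than the entry at position `i`. -/
def code {n : ℕ} (v : Equiv.Perm (Fin n)) (i : Fin n) : ℕ :=
  Finset.card {j : Fin n | i < j ∧ v j < v i}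

end Schubert

/-!
Let `i` be an ascent of `w` and `r` the number of occurrences of 132 at positions `i, i + 1, k`.
The code of `w s_i` arises from a vector `b` with `b i = b (i + 1)` by adding `r + 1` at `i`, and
`∂_i` is linear over polynomials symmetric in `x_i, x_{i+1}`; hence `∂_i` maps `x ^ code (w s_i)` to
`x ^ b * ∑ a ≤ r, x_i ^ a * x_{i+1} ^ (r - a)`.

For dominant `w` one has `r = 0` and `b = code w`. If `i` is the first ascent, all earlier entries
exceed `w i`, so `w s_i` is dominant again, and `𝔖_w = x ^ code w` follows by induction.

If `i, j, k` is the only occurrence of 132, an entry between the positions `i` and `j`, or an entry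
before `i` and smaller than `w i`, would belong to a second occurrence. So `j = i + 1`, `w s_i` is
dominant, `r = 1`, and `𝔖_w = ∂_i 𝔖_{w s_i} = x ^ b * (x_i + x_{i+1})`. Here `i` need not be the
first ascent of `w`, so the recursion is used at an arbitrary ascent; it holds there by the
commutation and braid relations of divided differences.
-/

namespace Schubert

open MvPolynomial Equiv

variable {n : ℕ}

/-! ### Divided differences -/

section DividedDifferences

variable {i j k l : Fin n} {f g : MvPolynomial (Fin n) ℤ}

theorem X_sub_X_ne_zero {σ R : Type*} [CommRing R] [Nontrivial R] {a b : σ} (h : a ≠ b) :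
    (X a - X b : MvPolynomial σ R) ≠ 0 :=
  sub_ne_zero.2 (X_injective.ne h)

theorem rename_perm_mul {σ R : Type*} [CommSemiring R] (s t : Perm σ) (p : MvPolynomial σ R) :
    rename (s * t) p = rename s (rename t p) :=
  (rename_rename t s p).symm

theorem divDiff_eq_iff (hij : i ≠ j) :
    divDiff i j f = g ↔ f - rename (swap i j) f = (X i - X j) * g := by
  rw [divDiff_spec, mul_right_inj' (X_sub_X_ne_zero hij)]

theorem divDiff_neg (hij : i ≠ j) (f : MvPolynomial (Fin n) ℤ) :
    divDiff i j (-f) = -divDiff i j f := by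
  rw [divDiff_eq_iff hij, map_neg]
  linear_combination -divDiff_spec i j f

theorem divDiff_sub (hij : i ≠ j) (f g : MvPolynomial (Fin n) ℤ) :
    divDiff i j (f - g) = divDiff i j f - divDiff i j g := by
  rw [divDiff_eq_iff hij, map_sub]
  linear_combination divDiff_spec i j f - divDiff_spec i j g

theorem divDiff_symmetric_mul (hij : i ≠ j) (hg : rename (swap i j) g = g)
    (f : MvPolynomial (Fin n) ℤ) : divDiff i j (g * f) = g * divDiff i j f := by
  rw [divDiff_eq_iff hij, map_mul, hg]
  linear_combination g * divDiff_spec i j f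

theorem divDiff_swap_indices (hij : i ≠ j) (f : MvPolynomial (Fin n) ℤ) :
    divDiff j i f = -divDiff i j f := by
  rw [divDiff_eq_iff hij.symm, swap_comm]
  linear_combination divDiff_spec i j f

theorem rename_divDiff (s : Perm (Fin n)) (hij : i ≠ j) (f : MvPolynomial (Fin n) ℤ) :
    rename s (divDiff i j f) = divDiff (s i) (s j) (rename s f) := by
  symm
  rw [divDiff_eq_iff (s.injective.ne hij), ← rename_perm_mul, ← mul_swap_eq_swap_mul,
    rename_perm_mul, ← map_sub, divDiff_spec, map_mul, map_sub, rename_X, rename_X]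

theorem rename_swap_divDiff (hij : i ≠ j) (f : MvPolynomial (Fin n) ℤ) :
    rename (swap i j) (divDiff i j f) = divDiff i j f := by
  rw [rename_divDiff _ hij, swap_apply_left, swap_apply_right, divDiff_eq_iff hij.symm,
    ← rename_perm_mul, swap_comm j i, swap_mul_self, Perm.coe_one, rename_id_apply]
  linear_combination -divDiff_spec i j f

theorem divDiff_comm (hij : i ≠ j) (hkl : k ≠ l) (hik : i ≠ k) (hil : i ≠ l) (hjk : j ≠ k)
    (hjl : j ≠ l) (f : MvPolynomial (Fin n) ℤ) :
    divDiff i j (divDiff k l f) = divDiff k l (divDiff i j f) := by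
  have hsymm : rename (swap k l) (X i - X j : MvPolynomial (Fin n) ℤ) = X i - X j := by
    simp only [map_sub, rename_X, swap_apply_of_ne_of_ne hik hil, swap_apply_of_ne_of_ne hjk hjl]
  rw [divDiff_eq_iff hij]
  calc divDiff k l f - rename (swap i j) (divDiff k l f)
      = divDiff k l (f - rename (swap i j) f) := by
        rw [rename_divDiff _ hkl, swap_apply_of_ne_of_ne hik.symm hjk.symm,
          swap_apply_of_ne_of_ne hil.symm hjl.symm, divDiff_sub hkl]
    _ = (X i - X j) * divDiff k l (divDiff i j f) := by
        rw [divDiff_spec, divDiff_symmetric_mul hkl hsymm]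

/-- The right-hand side is the antisymmetrization of `f` in `x_i, x_j, x_k`. As it only changes sign
under `i ↔ k`, the braid relation is a symmetry of this formula. -/
theorem vandermonde_mul_divDiff_divDiff_divDiff (hij : i ≠ j) (hjk : j ≠ k) (hik : i ≠ k)
    (f : MvPolynomial (Fin n) ℤ) :
    (X i - X j) * (X j - X k) * (X i - X k) * divDiff i j (divDiff j k (divDiff i j f))
      = f - rename (swap i j) f - rename (swap j k) f - rename (swap i k) f
        + rename (swap j k * swap i j) f + rename (swap i k * swap i j) f := by
  set h := divDiff i j f
  have outer : divDiff j k h - divDiff i k h = (X i - X j) * divDiff i j (divDiff j k h) := by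
    rw [← divDiff_spec, rename_divDiff _ hjk, rename_swap_divDiff hij, swap_apply_right,
      swap_apply_of_ne_of_ne hik.symm hjk.symm]
  have inner : f - rename (swap i j) f = (X i - X j) * h := divDiff_spec i j f
  have inner_jk := congrArg (rename (swap j k)) inner
  have inner_ik := congrArg (rename (swap i k)) inner
  simp only [map_sub, map_mul, rename_X, ← rename_perm_mul, swap_apply_left,
    swap_apply_of_ne_of_ne hij hik, swap_apply_of_ne_of_ne hij.symm hjk] at inner_jk inner_ik
  linear_combination -(X j - X k) * (X i - X k) * outer - (X i - X k) * divDiff_spec j k h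
    + (X j - X k) * divDiff_spec i k h - inner + inner_jk + inner_ik

theorem divDiff_braid (hij : i ≠ j) (hjk : j ≠ k) (hik : i ≠ k) (f : MvPolynomial (Fin n) ℤ) :
    divDiff i j (divDiff j k (divDiff i j f)) = divDiff j k (divDiff i j (divDiff j k f)) := by
  have hne := mul_ne_zero (mul_ne_zero (X_sub_X_ne_zero (R := ℤ) hij) (X_sub_X_ne_zero hjk))
    (X_sub_X_ne_zero hik)
  have reversed := vandermonde_mul_divDiff_divDiff_divDiff hjk.symm hij.symm hik.symm f
  have cycle : swap j k * swap i j = swap i k * swap j k := by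
    rw [mul_swap_eq_swap_mul, swap_apply_left, swap_apply_of_ne_of_ne hij hik]
  have cycle_inv : swap i j * swap j k = swap i k * swap i j := by
    rw [mul_swap_eq_swap_mul, swap_apply_right, swap_apply_of_ne_of_ne hik.symm hjk.symm]
  simp only [divDiff_swap_indices hij, divDiff_swap_indices hjk, divDiff_neg hij, divDiff_neg hjk,
    swap_comm k j, swap_comm j i, swap_comm k i, ← cycle, cycle_inv] at reversed
  refine mul_left_cancel₀ hne ?_
  linear_combination vandermonde_mul_divDiff_divDiff_divDiff hij hjk hik f - reversed

theorem divDiff_X_pow (hij : i ≠ j) (r : ℕ) :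
    divDiff i j (X i ^ r) = ∑ a ∈ Finset.range r, X i ^ a * X j ^ (r - 1 - a) := by
  rw [divDiff_eq_iff hij, map_pow, rename_X, swap_apply_left, (Commute.all _ _).mul_geom_sum₂]

theorem rename_swap_prod_X_pow {σ R : Type*} [Fintype σ] [DecidableEq σ] [CommSemiring R]
    {a b : σ} {c : σ → ℕ} (hc : c a = c b) :
    rename (swap a b) (∏ m, X m ^ c m : MvPolynomial σ R) = ∏ m, X m ^ c m := by
  have hcomp (m : σ) : c (swap a b m) = c m := by
    rw [swap_apply_def]
    split_ifs <;> simp_all only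
  simp only [map_prod, map_pow, rename_X]
  exact Fintype.prod_equiv (swap a b) _ _ fun m => by rw [hcomp]

theorem divDiff_prod_X_pow_add_single (hij : i ≠ j) {c : Fin n → ℕ} (hc : c i = c j) (r : ℕ) :
    divDiff i j (∏ m, X m ^ (c + Pi.single i r : Fin n → ℕ) m)
      = (∏ m, X m ^ c m) * ∑ a ∈ Finset.range r, X i ^ a * X j ^ (r - 1 - a) := by
  have hfactor : (∏ m, X m ^ (c + Pi.single i r : Fin n → ℕ) m : MvPolynomial (Fin n) ℤ)
      = (∏ m, X m ^ c m) * X i ^ r := by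
    simp only [Pi.add_apply, pow_add, Finset.prod_mul_distrib, Pi.single_apply, pow_ite, pow_zero,
      Finset.prod_ite_eq', Finset.mem_univ, if_true]
  rw [hfactor, divDiff_symmetric_mul hij (rename_swap_prod_X_pow hc), divDiff_X_pow hij]

end DividedDifferences

/-! ### Independence of the ascent -/

section Recursion

variable {w : Perm (Fin n)} {i j k l : Fin n}

/-- The statistic `∑ p, p * w p`, which decreases along the recursion defining `schubert`. -/
def weight (w : Perm (Fin n)) : ℕ :=
  ∑ p : Fin n, (p : ℕ) * (w p : ℕ)

/-- The recursion `𝔖_w = ∂_i 𝔖_{w s_i}` at every ascent `i` of `w`, while the definition of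
`schubert` provides it at the first ascent only. -/
def RecursionAt (w : Perm (Fin n)) : Prop :=
  ∀ i j, IsAscent w i j → schubert w = divDiff i j (schubert (w * swap i j))

theorem IsAscent.covBy (h : IsAscent w i j) : i ⋖ j := by
  simpa using h.1

theorem IsAscent.lt (h : IsAscent w i j) : i < j :=
  h.covBy.lt

theorem IsAscent.weight_mul_swap_lt (h : IsAscent w i j) : weight (w * swap i j) < weight w :=
  sum_mul_swap_lt w i j h

theorem IsAscent.mul_swap_of_disjoint (h : IsAscent w k l) (hik : i ≠ k) (hil : i ≠ l)
    (hjk : j ≠ k) (hjl : j ≠ l) : IsAscent (w * swap i j) k l := by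
  refine ⟨h.1, ?_⟩
  simpa only [Perm.mul_apply, swap_apply_of_ne_of_ne hik.symm hjk.symm,
    swap_apply_of_ne_of_ne hil.symm hjl.symm] using h.2

theorem divDiff_schubert_eq_of_disjoint (hij : IsAscent w i j) (hkl : IsAscent w k l)
    (hik : i ≠ k) (hil : i ≠ l) (hjk : j ≠ k) (hjl : j ≠ l)
    (ih : ∀ v : Perm (Fin n), weight v < weight w → RecursionAt v) :
    divDiff i j (schubert (w * swap i j)) = divDiff k l (schubert (w * swap k l)) := by
  have hcomm : swap i j * swap k l = swap k l * swap i j :=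
    (Perm.disjoint_swap_swap (by simp [hij.lt.ne, hkl.lt.ne, *])).commute
  rw [ih _ hij.weight_mul_swap_lt k l (hkl.mul_swap_of_disjoint hik hil hjk hjl),
    ih _ hkl.weight_mul_swap_lt i j (hij.mul_swap_of_disjoint hik.symm hjk.symm hil.symm hjl.symm),
    mul_assoc, mul_assoc, hcomm, divDiff_comm hij.lt.ne hkl.lt.ne hik hil hjk hjl]

theorem swap_braid {α : Type*} [DecidableEq α] {a b c : α} (hab : a ≠ b) (hbc : b ≠ c)
    (hac : a ≠ c) : swap a b * swap b c * swap a b = swap b c * swap a b * swap b c := by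
  rw [swap_mul_swap_mul_swap hab hac, swap_comm a b, swap_comm b c,
    swap_mul_swap_mul_swap hbc.symm hac.symm, swap_comm]

theorem divDiff_schubert_eq_of_consecutive (hij : IsAscent w i j) (hjk : IsAscent w j k)
    (ih : ∀ v : Perm (Fin n), weight v < weight w → RecursionAt v) :
    divDiff i j (schubert (w * swap i j)) = divDiff j k (schubert (w * swap j k)) := by
  have ne_ij := hij.lt.ne
  have ne_jk := hjk.lt.ne
  have ne_ik := (hij.lt.trans hjk.lt).ne
  have fix_k : swap i j k = k := swap_apply_of_ne_of_ne ne_ik.symm ne_jk.symm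
  have fix_i : swap j k i = i := swap_apply_of_ne_of_ne ne_ij ne_ik
  have lt_ik : w i < w k := hij.2.trans hjk.2
  have asc_jk : IsAscent (w * swap i j) j k := ⟨hjk.1, by simpa [fix_k] using lt_ik⟩
  have asc_jk_ij : IsAscent (w * swap i j * swap j k) i j :=
    ⟨hij.1, by simpa [fix_k, fix_i] using hjk.2⟩
  have asc_ij : IsAscent (w * swap j k) i j := ⟨hij.1, by simpa [fix_i] using lt_ik⟩
  have asc_ij_jk : IsAscent (w * swap j k * swap i j) j k :=
    ⟨hjk.1, by simpa [fix_k, fix_i] using hij.2⟩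
  have hbraid : w * swap i j * swap j k * swap i j = w * swap j k * swap i j * swap j k := by
    simpa only [mul_assoc] using congrArg (w * ·) (swap_braid ne_ij ne_jk ne_ik)
  rw [ih _ hij.weight_mul_swap_lt j k asc_jk,
    ih _ (asc_jk.weight_mul_swap_lt.trans hij.weight_mul_swap_lt) i j asc_jk_ij,
    ih _ hjk.weight_mul_swap_lt i j asc_ij,
    ih _ (asc_ij.weight_mul_swap_lt.trans hjk.weight_mul_swap_lt) j k asc_ij_jk,
    hbraid, divDiff_braid ne_ij ne_jk ne_ik]

theorem recursionAt (w : Perm (Fin n)) : RecursionAt w := by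
  induction w using (measure weight).wf.induction with | _ w ih
  intro i j hij
  obtain ⟨p, q, hpq, hmin, hdef⟩ : ∃ p q, IsAscent w p q ∧ (∀ a b, IsAscent w a b → p ≤ a) ∧
      schubert w = divDiff p q (schubert (w * swap p q)) := by
    have hasc : ∃ p : Fin n × Fin n, IsAscent w p.1 p.2 := ⟨(i, j), hij⟩
    obtain ⟨hfirst, hmin⟩ := (exists_first_ascent hasc).choose_spec
    exact ⟨_, _, hfirst, fun a b hab => hmin (a, b) hab, by rw [schubert, dif_pos hasc]⟩
  rw [hdef]
  rcases (hmin i j hij).eq_or_lt with rfl | hpi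
  · rw [hpq.covBy.unique_right hij.covBy]
  have hqi : q ≤ i := hpq.covBy.ge_of_gt hpi
  have hqj : q < j := hqi.trans_lt hij.lt
  rcases hqi.eq_or_lt with rfl | hqi
  · exact divDiff_schubert_eq_of_consecutive hpq hij ih
  · exact divDiff_schubert_eq_of_disjoint hpq hij hpi.ne (hpi.trans hij.lt).ne hqi.ne hqj.ne ih

theorem schubert_eq_divDiff (h : IsAscent w i j) :
    schubert w = divDiff i j (schubert (w * swap i j)) :=
  recursionAt w i j h

theorem schubert_of_forall_not_isAscent (h : ∀ i j, ¬ IsAscent w i j) :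
    schubert w = ∏ i : Fin n, X i ^ (n - 1 - (i : ℕ)) := by
  rw [schubert, dif_neg fun ⟨p, hp⟩ => h p.1 p.2 hp]

end Recursion

/-! ### Exchanging the entries at an ascent -/

section Exchange

variable {w : Perm (Fin n)} {i j : Fin n}

theorem mem_occurrences132 {a b c : Fin n} :
    (a, b, c) ∈ occurrences132 w ↔ a < b ∧ b < c ∧ w a < w c ∧ w c < w b := by
  simp [occurrences132]

theorem swap_lt_swap_of_covBy {α : Type*} [LinearOrder α] {a b x y : α} (hab : a ⋖ b)
    (hxy : x < y) (hne : ¬ (x = a ∧ y = b)) : swap a b x < swap a b y := by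
  have hlt := hab.lt
  have hright : a < y → b ≤ y := hab.ge_of_gt
  have hleft : x < b → x ≤ a := hab.le_of_lt
  grind

theorem IsAscent.mul_swap_apply_of_gt {k : Fin n} (h : IsAscent w i j) (hk : j < k) :
    (w * swap i j) k = w k := by
  rw [Perm.mul_apply, swap_apply_of_ne_of_ne (h.lt.trans hk).ne' hk.ne']

theorem code_mul_swap_left (h : IsAscent w i j) : code (w * swap i j) i = code w j + 1 := by
  have hset : ({k : Fin n | i < k ∧ (w * swap i j) k < (w * swap i j) i} : Finset (Fin n))
      = insert j ({k : Fin n | j < k ∧ w k < w j} : Finset (Fin n)) := by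
    ext k
    have hsucc := h.covBy.lt_iff_le_right (z := k)
    have hfix := h.mul_swap_apply_of_gt (k := k)
    have hij := h.2
    have hi : (w * swap i j) i = w j := by simp
    have hj : (w * swap i j) j = w i := by simp
    simp only [Finset.mem_filter, Finset.mem_univ, true_and, Finset.mem_insert]
    grind
  rw [code, hset, Finset.card_insert_of_notMem (by simp), code]

theorem code_mul_swap_right (h : IsAscent w i j) : code (w * swap i j) j = code w i := by
  refine congrArg Finset.card (Finset.filter_congr fun k _ => ?_)
  have hsucc := h.covBy.lt_iff_le_right (z := k)
  have hfix := h.mul_swap_apply_of_gt (k := k)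
  have hij := h.2
  have hj : (w * swap i j) j = w i := by simp
  grind

theorem code_mul_swap_of_ne {m : Fin n} (h : IsAscent w i j) (hi : m ≠ i) (hj : m ≠ j) :
    code (w * swap i j) m = code w m := by
  have hm : swap i j m = m := swap_apply_of_ne_of_ne hi hj
  refine Finset.card_equiv (swap i j) fun k => ?_
  have hlt : m < swap i j k ↔ m < k := by
    refine ⟨fun hk => ?_, fun hk => ?_⟩
    · simpa [hm] using swap_lt_swap_of_covBy h.covBy hk (by simp [hi])
    · simpa [hm] using swap_lt_swap_of_covBy h.covBy hk (by simp [hi])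
  simp [hlt, hm]

theorem code_right_eq_add_card (h : IsAscent w i j) :
    code w j = code w i + Finset.card {k : Fin n | (i, j, k) ∈ occurrences132 w} := by
  have hdisj : Disjoint ({k : Fin n | i < k ∧ w k < w i} : Finset (Fin n))
      ({k : Fin n | (i, j, k) ∈ occurrences132 w} : Finset (Fin n)) := by
    refine Finset.disjoint_filter.2 fun k _ hk hocc => ?_
    exact hk.2.not_gt (mem_occurrences132.1 hocc).2.2.1
  rw [code, code, ← Finset.card_union_of_disjoint hdisj]
  congr 1
  ext k
  have hsucc := h.covBy.lt_iff_le_right (z := k)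
  have hinj := w.injective.eq_iff (a := k) (b := i)
  have hasc := h.2
  have hlt := h.lt
  simp only [Finset.mem_union, Finset.mem_filter, Finset.mem_univ, true_and, mem_occurrences132]
  grind

theorem code_mul_swap (h : IsAscent w i j) {r : ℕ} (hr : code w j = code w i + r) :
    code (w * swap i j) = Function.update (code w) j (code w i) + Pi.single i (r + 1) := by
  ext m
  rcases eq_or_ne m i with rfl | hi
  · simp [code_mul_swap_left h, hr, h.lt.ne, add_assoc]
  rcases eq_or_ne m j with rfl | hj
  · simp [code_mul_swap_right h, hi]
  · simp [code_mul_swap_of_ne h hi hj, hi, hj]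

theorem divDiff_prod_X_pow_code_mul_swap (h : IsAscent w i j) {r : ℕ}
    (hr : code w j = code w i + r) :
    divDiff i j (∏ m, X m ^ code (w * swap i j) m)
      = (∏ m, X m ^ Function.update (code w) j (code w i) m)
        * ∑ a ∈ Finset.range (r + 1), X i ^ a * X j ^ (r - a) := by
  rw [code_mul_swap h hr, divDiff_prod_X_pow_add_single h.lt.ne (by simp [h.lt.ne]),
    Nat.add_sub_cancel]

theorem isDominant_mul_swap (h : IsAscent w i j) (hbefore : ∀ a < i, w i < w a)
    (hocc : ∀ a b c, (a, b, c) ∈ occurrences132 w → a = i ∧ b = j) :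
    IsDominant (w * swap i j) := by
  refine Finset.eq_empty_of_forall_notMem ?_
  rintro ⟨a, b, c⟩ habc
  obtain ⟨hab, hbc, hac_entries, hcb_entries⟩ := mem_occurrences132.1 habc
  have hab_ne : ¬ (a = i ∧ b = j) := by
    rintro ⟨rfl, rfl⟩
    exact (hac_entries.trans hcb_entries).not_gt (by simpa using h.2)
  have hbc_ne : ¬ (b = i ∧ c = j) := by
    rintro ⟨rfl, rfl⟩
    refine (hbefore a hab).not_gt ?_
    simpa [swap_apply_of_ne_of_ne hab.ne (hab.trans hbc).ne] using hac_entries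
  have hmem : (swap i j a, swap i j b, swap i j c) ∈ occurrences132 w :=
    mem_occurrences132.2 ⟨swap_lt_swap_of_covBy h.covBy hab hab_ne,
      swap_lt_swap_of_covBy h.covBy hbc hbc_ne, hac_entries, hcb_entries⟩
  obtain ⟨ha, hb⟩ := hocc _ _ _ hmem
  rw [swap_apply_eq_iff, swap_apply_left] at ha
  rw [swap_apply_eq_iff, swap_apply_right] at hb
  exact hab.not_gt (ha ▸ hb ▸ h.lt)

end Exchange

/-! ### Dominant permutations -/

section Dominant

variable {w : Perm (Fin n)}

theorem strictAntiOn_Iic_of_forall_isAscent_le {i : Fin n} (h : ∀ a b, IsAscent w a b → i ≤ a) :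
    StrictAntiOn w (Set.Iic i) := by
  refine strictAntiOn_Iic_of_succ_lt fun a ha => ?_
  have hcov : a ⋖ Order.succ a := Order.covBy_succ_of_not_isMax ha.not_isMax
  by_contra hle
  have hlt : w a < w (Order.succ a) := (not_lt.1 hle).lt_of_ne (w.injective.ne hcov.lt.ne)
  exact (h _ _ ⟨by simpa using hcov, hlt⟩).not_gt ha

theorem code_of_forall_not_isAscent (h : ∀ i j, ¬ IsAscent w i j) (i : Fin n) :
    code w i = n - 1 - i := by
  have hanti {k : Fin n} (hik : i < k) : w k < w i :=
    strictAntiOn_Iic_of_forall_isAscent_le (fun a b hab => (h a b hab).elim) hik.le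
      (Set.mem_Iic.2 le_rfl) hik
  rw [← Fin.card_Ioi, code]
  congr 1
  ext k
  simpa using hanti

theorem schubert_of_isDominant (hw : IsDominant w) : schubert w = ∏ m, X m ^ code w m := by
  induction w using (measure weight).wf.induction with | _ w ih
  by_cases hasc : ∃ p : Fin n × Fin n, IsAscent w p.1 p.2
  · obtain ⟨⟨i, j⟩, hij, hmin⟩ := exists_first_ascent hasc
    have hanti := strictAntiOn_Iic_of_forall_isAscent_le fun a b hab => hmin (a, b) hab
    have hempty : occurrences132 w = ∅ := hw
    have hdom : IsDominant (w * swap i j) :=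
      isDominant_mul_swap hij (fun a ha => hanti ha.le (Set.mem_Iic.2 le_rfl) ha)
        fun a b c habc => by simp [hempty] at habc
    have hcode : code w j = code w i := by simp [code_right_eq_add_card hij, hempty]
    rw [schubert_eq_divDiff hij, ih _ hij.weight_mul_swap_lt hdom,
      divDiff_prod_X_pow_code_mul_swap (r := 0) hij hcode, ← hcode, Function.update_eq_self]
    simp
  · have hnone : ∀ i j, ¬ IsAscent w i j := fun i j hij => hasc ⟨(i, j), hij⟩
    simp only [schubert_of_forall_not_isAscent hnone, code_of_forall_not_isAscent hnone]

end Dominant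

/-! ### Permutations with exactly one occurrence of 132 -/

section Singleton

variable {w : Perm (Fin n)} {i j k : Fin n}

theorem covBy_of_occurrences132_eq_singleton (hw : occurrences132 w = {(i, j, k)}) : i ⋖ j := by
  have huniq (a b c) : (a, b, c) ∈ occurrences132 w ↔ a = i ∧ b = j ∧ c = k := by simp [hw]
  obtain ⟨hij, hjk, hik_entries, hkj_entries⟩ :=
    mem_occurrences132.1 ((huniq i j k).2 ⟨rfl, rfl, rfl⟩)
  refine ⟨hij, fun m him hmj => ?_⟩
  rcases lt_or_gt_of_ne (w.injective.ne (hmj.trans hjk).ne) with hmk | hkm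
  · exact him.ne' ((huniq m j k).1 (mem_occurrences132.2 ⟨hmj, hjk, hmk, hkj_entries⟩)).1
  · exact hmj.ne
      ((huniq i m k).1 (mem_occurrences132.2 ⟨him, hmj.trans hjk, hik_entries, hkm⟩)).2.1

theorem isAscent_of_occurrences132_eq_singleton (hw : occurrences132 w = {(i, j, k)}) :
    IsAscent w i j := by
  obtain ⟨-, -, hik_entries, hkj_entries⟩ :=
    mem_occurrences132.1 (hw ▸ Finset.mem_singleton_self (i, j, k))
  exact ⟨by simpa using covBy_of_occurrences132_eq_singleton hw, hik_entries.trans hkj_entries⟩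

theorem isDominant_mul_swap_of_occurrences132_eq_singleton
    (hw : occurrences132 w = {(i, j, k)}) : IsDominant (w * swap i j) := by
  have huniq (a b c) : (a, b, c) ∈ occurrences132 w ↔ a = i ∧ b = j ∧ c = k := by simp [hw]
  obtain ⟨hij, hjk, hik_entries, hkj_entries⟩ :=
    mem_occurrences132.1 ((huniq i j k).2 ⟨rfl, rfl, rfl⟩)
  refine isDominant_mul_swap (isAscent_of_occurrences132_eq_singleton hw) (fun a ha => ?_)
    fun a b c habc => ⟨((huniq a b c).1 habc).1, ((huniq a b c).1 habc).2.1⟩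
  by_contra hle
  have hai : w a < w i := (not_lt.1 hle).lt_of_ne (w.injective.ne ha.ne)
  exact ha.ne ((huniq a j k).1
    (mem_occurrences132.2 ⟨ha.trans hij, hjk, hai.trans hik_entries, hkj_entries⟩)).1

theorem code_right_of_occurrences132_eq_singleton (hw : occurrences132 w = {(i, j, k)}) :
    code w j = code w i + 1 := by
  rw [code_right_eq_add_card (isAscent_of_occurrences132_eq_singleton hw), hw]
  simp [Finset.filter_eq']

theorem schubert_of_occurrences132_eq_singleton (hw : occurrences132 w = {(i, j, k)}) :
    schubert w = (∏ m, X m ^ Function.update (code w) j (code w i) m) * (X i + X j) := by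
  have hasc := isAscent_of_occurrences132_eq_singleton hw
  rw [schubert_eq_divDiff hasc,
    schubert_of_isDominant (isDominant_mul_swap_of_occurrences132_eq_singleton hw),
    divDiff_prod_X_pow_code_mul_swap hasc (code_right_of_occurrences132_eq_singleton hw)]
  simp [Finset.sum_range_succ, add_comm]

theorem exists_prod_X_pow_mul_add_eq_monomial_add_monomial {σ R : Type*} [Fintype σ]
    [CommSemiring R] (c : σ → ℕ) {a b : σ} (hab : a ≠ b) :
    ∃ d e : σ →₀ ℕ, d ≠ e ∧
      (∏ m, X m ^ c m) * (X a + X b : MvPolynomial σ R) = monomial d 1 + monomial e 1 := by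
  rw [prod_X_pow, mul_add, X, X, monomial_mul, monomial_mul, mul_one]
  exact ⟨_, _, fun h => hab (Finsupp.single_left_injective one_ne_zero (add_left_cancel h)), rfl⟩

end Singleton

end Schubert

theorem mainTheorem3 (n : ℕ) (w : Equiv.Perm (Fin n))
    (hw : (Schubert.occurrences132 w).card = 1) :
    Schubert.nu w = 2 ∧
    ∃ i j k : Fin n,
      (i : ℕ) + 1 = j ∧
      Schubert.occurrences132 w = {(i, j, k)} ∧
      Schubert.IsDominant (w * Equiv.swap i j) ∧
      Schubert.code (w * Equiv.swap i j) i = Schubert.code (w * Equiv.swap i j) j + 2 ∧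
      Schubert.schubert (w * Equiv.swap i j) =
        ∏ m : Fin n, MvPolynomial.X m ^ Schubert.code (w * Equiv.swap i j) m ∧
      Schubert.schubert w =
        Schubert.divDiff i j (Schubert.schubert (w * Equiv.swap i j)) ∧
      ∃ d e : Fin n →₀ ℕ, d ≠ e ∧
        Schubert.schubert w = MvPolynomial.monomial d 1 + MvPolynomial.monomial e 1 := by
  obtain ⟨⟨i, j, k⟩, hocc⟩ := Finset.card_eq_one.1 hw
  have hasc := Schubert.isAscent_of_occurrences132_eq_singleton hocc
  have hdom := Schubert.isDominant_mul_swap_of_occurrences132_eq_singleton hocc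
  have hcode : Schubert.code (w * Equiv.swap i j) i
      = Schubert.code (w * Equiv.swap i j) j + 2 := by
    rw [Schubert.code_mul_swap_left hasc, Schubert.code_mul_swap_right hasc,
      Schubert.code_right_of_occurrences132_eq_singleton hocc]
  have hschubert := Schubert.schubert_of_occurrences132_eq_singleton hocc
  refine ⟨?_, i, j, k, hasc.1, hocc, hdom, hcode, Schubert.schubert_of_isDominant hdom,
    Schubert.schubert_eq_divDiff hasc, ?_⟩
  · simp [Schubert.nu, hschubert]
  · rw [hschubert]
    exact Schubert.exists_prod_X_pow_mul_add_eq_monomial_add_monomial _ hasc.lt.ne
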